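/- Let $K$ be a zero-dimensional compact Hausdorff space (zero-dimensional: the clopen sets form a basis of the topology). Let $K'$ be the set of accumulation points of $K$, and suppose that the set $K\setminus K'$ of isolated points is dense in $K$ and that $K'$ is a $G_\delta$ subset of $K$. Let $C(K)$ be the Banach space of real-valued continuous functions on $K$ with the supremum norm, let $B_{C(K)}$ be its closed unit ball, and let $F:B_{C(K)}\to B_{C(K)}$ be a non-expansive (that is, $1$-Lipschitz) bijection. If at least one of the following two conditions holds, then $F$ is an isometry. (i) $F$ has the following property $(*)$: for any $u,v,z\in K$ with $u\neq v$ and any sign $\omega\in\{-1,1\}$, there exists $f\in B_{C(K)}$ such that $f(u)f(v)$ is non-zero with sign $\omega$ and $|F(f)|\equiv 1$ in a neighbourhood of $z$. (ii) $\inf\{\,\|F(\omega\mathbf 1_{\{a\}})\| : a\in K\setminus K',\ \omega=\pm1\,\}>1/2$, where $\mathbf 1_{\{a\}}$ is the indicator function of $\{a\}$ (and $\inf\emptyset=+\infty$). -/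

import Mathlib

open Set Topology
open scoped ENNReal

/-- The closed unit ball `B_{C(K)}` of the Banach space `C(K)` of real-valued continuous functions
on a compact space `K`, with the metric given by the supremum norm. -/
abbrev UnitBall (K : Type*) [TopologicalSpace K] [CompactSpace K] : Type _ :=
  ↥(Metric.closedBall (0 : C(K, ℝ)) 1)

/-- The set `K'` of all accumulation points of the space `K`. -/
abbrev accPoints (K : Type*) [TopologicalSpace K] : Set K :=
  derivedSet (univ : Set K)

theorem isOpen_singleton_of_notMem_accPoints {K : Type*} [TopologicalSpace K] {a : K}
    (ha : a ∉ accPoints K) : IsOpen ({a} : Set K) := by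
  rw [isOpen_singleton_iff_punctured_nhds]
  simpa [accPoints, mem_derivedSet, AccPt, Filter.not_neBot] using ha

/-- For an isolated point `a` of `K` and a sign `ω = ±1`, the element `ω 𝟙_{a}` of the closed unit
ball of `C(K)`. -/
noncomputable def signedIndicator {K : Type*} [TopologicalSpace K] [CompactSpace K] [T2Space K]
    (a : ↥(accPoints K)ᶜ) (ω : ℤˣ) : UnitBall K :=
  ⟨{ toFun := Set.indicator {(a : K)} (fun _ => ((ω : ℤ) : ℝ))
     continuous_toFun :=
       IsClopen.continuous_indicator
         ⟨isClosed_singleton, isOpen_singleton_of_notMem_accPoints a.2⟩ continuous_const }, by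
    rw [mem_closedBall_zero_iff, ContinuousMap.norm_le _ zero_le_one]
    intro x
    rcases Int.units_eq_one_or ω with h | h <;>
      by_cases hx : x = (a : K) <;> simp [h, hx]⟩

/-- Property `(*)` of a self-map `F` of the closed unit ball of `C(K)`. -/
def PropertyStar {K : Type*} [TopologicalSpace K] [CompactSpace K]
    (F : UnitBall K → UnitBall K) : Prop :=
  ∀ u v z : K, u ≠ v → ∀ ω : ℤˣ, ∃ f : UnitBall K,
    Real.sign (f.1 u * f.1 v) = ((ω : ℤ) : ℝ) ∧ ∀ᶠ x in 𝓝 z, |(F f).1 x| = 1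

/-!
The inverse `G` of `F` maps sign functions (the extreme points of the ball, that is, the continuous
`e` with `|e| = 1`) to sign functions, and `G (-e) = -G e`: the point of the ball at distance at
most `r` from `e` and at most `2 - r` from `-e`, or at most `1 - r` from `0`, is unique, so `F`
would otherwise identify distinct points (`isSign_of_isSign_apply`, `eq_neg_of_apply_eq_neg`). For an isolated point `a`, the
value of `G e` at `a` is tied by distances to the sign of `e` on the support of `F (𝟙_{a})`. Since
sign functions separate points, this support is a single point `σ a`. By density of the isolated
points, `σ` extends to a continuous surjection `σ : K → K` with `G e = G 1 * (e ∘ σ)` for all sign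
functions `e` (`exists_pointMap`). Either of the two alternative hypotheses forces `σ` to be
injective, hence a homeomorphism: if `σ u = σ v` with `u ≠ v`, functions of suitable signs at `u`
and `v` would be sent to functions with conflicting signs at `σ u`
(`injective_pointMap_of_exists_sign`, `injective_pointMap_of_lt_norm`).

After composition with the isometry `f ↦ G 1 * (f ∘ σ)`, the map fixes all sign functions, and it
remains to see that such a non-expansive bijection `F` is the identity
(`apply_eq_self_of_forall_isSign`). Comparison with sign functions gives `F f ≤ f` and
`min f ≤ F f` for strictly positive `f`. The main step concerns a box `[lo, hi]` of functions, with
`hi - lo` equal to `0` or to a constant, that is mapped onto itself by `F` with `F f ≤ f`. All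
corners of the box are fixed (`apply_corner_eq_self`), so comparison with corners shows that `F`
does not decrease the values that lie below the centre of the box (`min_midpoint_le_apply`). If `F`
does not decrease values up to a level `c < 1`, then boxes with values in `[c₀, 1]`, `c₀` close to
`c`, on a clopen set, and with prescribed values below `c` elsewhere, are mapped onto themselves;
so values up to `(1 + c₀) / 2 > c` are not decreased. Hence the supremum of such levels is `1`, and
`F` fixes all strictly positive functions. Multiplication by sign functions extends this to nowhere
vanishing functions, which are dense.
-/

section Plasticity

open Metric

variable {K : Type*} [TopologicalSpace K]

/-! ### Clopen sets and functions glued along them -/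

theorem exists_isClopen_between_levels [CompactSpace K] [T2Space K] [TotallyDisconnectedSpace K]
    (f : C(K, ℝ)) {s t : ℝ} (hst : s < t) :
    ∃ U : Set K, IsClopen U ∧ (∀ x, t ≤ f x → x ∈ U) ∧ ∀ x ∈ U, s < f x := by
  obtain ⟨U, hU, h1, h2⟩ := exists_clopen_of_closed_subset_open
    (isClosed_le continuous_const f.continuous : IsClosed {x | t ≤ f x})
    (isOpen_lt continuous_const f.continuous : IsOpen {x | s < f x})
    (fun x hx => lt_of_lt_of_le hst hx)
  exact ⟨U, hU, fun x hx => h1 hx, fun x hx => h2 hx⟩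

open Classical in
/-- The continuous function equal to `f` on the clopen set `U` and to `g` off `U`. -/
noncomputable def clopenGlue {U : Set K} (hU : IsClopen U) (f g : C(K, ℝ)) : C(K, ℝ) where
  toFun := U.piecewise f g
  continuous_toFun := by
    refine Continuous.piecewise ?_ f.continuous g.continuous
    simp [hU.frontier_eq]

theorem clopenGlue_of_mem {U : Set K} (hU : IsClopen U) (f g : C(K, ℝ)) {x : K} (hx : x ∈ U) :
    clopenGlue hU f g x = f x := by
  simp [clopenGlue, hx]

theorem clopenGlue_of_notMem {U : Set K} (hU : IsClopen U) (f g : C(K, ℝ)) {x : K}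
    (hx : x ∉ U) : clopenGlue hU f g x = g x := by
  simp [clopenGlue, hx]

/-- A continuous function with values in `{1, -1}`. On a compact space these are the extreme points
of the unit ball of `C(K)`. -/
def IsSign (e : C(K, ℝ)) : Prop := ∀ x, e x = 1 ∨ e x = -1

theorem IsSign.one : IsSign (1 : C(K, ℝ)) := fun _ => Or.inl rfl

theorem IsSign.neg {e : C(K, ℝ)} (he : IsSign e) : IsSign (-e) := fun x => by
  rcases he x with h | h <;> simp [h]

theorem IsSign.mul_self {e : C(K, ℝ)} (he : IsSign e) : e * e = 1 := by
  ext x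
  rcases he x with h | h <;> simp [h]

theorem IsSign.abs_apply {e : C(K, ℝ)} (he : IsSign e) (x : K) : |e x| = 1 := by
  rcases he x with h | h <;> simp [h]

theorem isSign_clopenGlue {U : Set K} (hU : IsClopen U) : IsSign (clopenGlue hU 1 (-1)) := by
  intro x
  by_cases hx : x ∈ U
  · simp [clopenGlue_of_mem hU _ _ hx]
  · simp [clopenGlue_of_notMem hU _ _ hx]

/-- The function `ω 𝟙_{a}` for an isolated point `a`. -/
noncomputable def spike [T2Space K] {a : K} (ha : IsOpen ({a} : Set K)) (ω : ℝ) : C(K, ℝ) :=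
  clopenGlue ⟨isClosed_singleton, ha⟩ (ContinuousMap.const K ω) 0

theorem spike_self [T2Space K] {a : K} (ha : IsOpen ({a} : Set K)) (ω : ℝ) : spike ha ω a = ω :=
  clopenGlue_of_mem _ _ _ rfl

theorem spike_of_ne [T2Space K] {a x : K} (ha : IsOpen ({a} : Set K)) (ω : ℝ) (hx : x ≠ a) :
    spike ha ω x = 0 :=
  clopenGlue_of_notMem _ _ _ hx

/-- A closed condition that holds at the isolated points of an open set holds on this set. -/
theorem mem_of_isolated_mem (hdense : Dense {a : K | IsOpen ({a} : Set K)}) {N C : Set K}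
    (hN : IsOpen N) (hC : IsClosed C) (h : ∀ a ∈ N, IsOpen ({a} : Set K) → a ∈ C) {x : K}
    (hx : x ∈ N) : x ∈ C :=
  (closure_minimal (fun a ha => h a ha.1 ha.2) hC) (hdense.open_subset_closure_inter hN hx)

variable [CompactSpace K]

theorem mem_unitBall_iff {f : C(K, ℝ)} : f ∈ closedBall (0 : C(K, ℝ)) 1 ↔ ∀ x, |f x| ≤ 1 := by
  rw [mem_closedBall_zero_iff, ContinuousMap.norm_le _ zero_le_one]
  rfl

theorem IsSign.mem_unitBall {e : C(K, ℝ)} (he : IsSign e) : e ∈ closedBall (0 : C(K, ℝ)) 1 :=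
  mem_unitBall_iff.2 fun x => (he.abs_apply x).le

theorem LipschitzOnWith.abs_apply_sub_le {F : C(K, ℝ) → C(K, ℝ)} {R : Set C(K, ℝ)}
    (hF : LipschitzOnWith 1 F R) {f g : C(K, ℝ)} (hf : f ∈ R) (hg : g ∈ R) {r : ℝ}
    (h : ∀ x, |f x - g x| ≤ r) (x : K) : |F f x - F g x| ≤ r := by
  have hr : 0 ≤ r := (abs_nonneg _).trans (h x)
  have h1 : dist f g ≤ r := (ContinuousMap.dist_le hr).2 h
  have h2 : dist (F f) (F g) ≤ r := by
    simpa using (hF.dist_le_mul f hf g hg).trans (by simpa using h1)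
  exact (ContinuousMap.dist_le hr).1 h2 x

theorem bijOn_sign_mul {e : C(K, ℝ)} (he : IsSign e) :
    BijOn (fun f => e * f) (closedBall (0 : C(K, ℝ)) 1) (closedBall (0 : C(K, ℝ)) 1) := by
  have hinv : ∀ f : C(K, ℝ), e * (e * f) = f := fun f => by
    rw [← mul_assoc, he.mul_self, one_mul]
  have hmaps : MapsTo (fun f => e * f) (closedBall (0 : C(K, ℝ)) 1)
      (closedBall (0 : C(K, ℝ)) 1) := fun f hf => mem_unitBall_iff.2 fun x => by
    have := mem_unitBall_iff.1 hf x
    simpa [abs_mul, he.abs_apply x] using this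
  exact InvOn.bijOn ⟨fun f _ => hinv f, fun f _ => hinv f⟩ hmaps hmaps

/-! ### Decreasing non-expansive bijections of a box -/

section Box

variable {lo hi : C(K, ℝ)} {ρ : ℝ} {F : C(K, ℝ) → C(K, ℝ)}

/-- A non-expansive bijection of a box that does not increase any function fixes every corner.
The top corner and hence the centre `m` are fixed. The preimages of two opposite corners have a
midpoint whose image lies within `ρ` of both corners, so that this midpoint is `m`; as the
preimages lie above the corners, they coincide with them. -/
theorem apply_corner_eq_self (hlh : ∀ x, hi x = lo x ∨ hi x = lo x + 2 * ρ) (hρ : 0 ≤ ρ)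
    (hbij : BijOn F (Icc lo hi) (Icc lo hi)) (hF : LipschitzOnWith 1 F (Icc lo hi))
    (hle : ∀ f ∈ Icc lo hi, F f ≤ f) {e : C(K, ℝ)} (he : ∀ x, e x = lo x ∨ e x = hi x) :
    F e = e := by
  have hmem : ∀ f : C(K, ℝ), f ∈ Icc lo hi ↔ ∀ x, lo x ≤ f x ∧ f x ≤ hi x := fun f => by
    simp only [mem_Icc, ContinuousMap.le_def, forall_and]
  have hlohi : ∀ x, lo x ≤ hi x := fun x => by rcases hlh x with h | h <;> linarith
  have hhi : hi ∈ Icc lo hi := (hmem _).2 fun x => ⟨hlohi x, le_rfl⟩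
  have Fhi : F hi = hi := by
    obtain ⟨f, hf, hfe⟩ := hbij.surjOn hhi
    have : f = hi := le_antisymm hf.2 (hfe ▸ hle f hf)
    rw [← this, hfe, this]
  set m : C(K, ℝ) := (1 / 2 : ℝ) • (lo + hi) with hm
  have mx : ∀ x, m x = (lo x + hi x) / 2 := fun x => by simp [hm]; ring
  have hmm : m ∈ Icc lo hi := (hmem _).2 fun x => by
    rw [mx]; constructor <;> linarith [hlohi x]
  have Fm : F m = m := by
    ext x
    have h1 : |F m x - F hi x| ≤ ρ := hF.abs_apply_sub_le hmm hhi (fun y => by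
      rw [mx, abs_le]
      rcases hlh y with h | h <;> constructor <;> linarith) x
    have h2 := ContinuousMap.le_def.1 (hle m hmm) x
    have h3 := (hmem _).1 (hbij.mapsTo hmm) x
    rw [Fhi, abs_le] at h1
    rw [mx] at h2 ⊢
    rcases hlh x with h | h <;> linarith
  set e' : C(K, ℝ) := lo + hi - e with he'
  have ex' : ∀ x, e' x = lo x + hi x - e x := fun x => by simp [he']
  have heR : e ∈ Icc lo hi := (hmem _).2 fun x => by
    rcases he x with h | h <;> simp [h, hlohi x]
  have heR' : e' ∈ Icc lo hi := (hmem _).2 fun x => by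
    rw [ex']
    rcases he x with h | h <;> simp [h, hlohi x]
  obtain ⟨f, hf, hfe⟩ := hbij.surjOn heR
  obtain ⟨f', hf', hfe'⟩ := hbij.surjOn heR'
  have f1 := (hmem _).1 hf
  have f1' := (hmem _).1 hf'
  set k : C(K, ℝ) := (1 / 2 : ℝ) • (f + f') with hk
  have kx : ∀ x, k x = (f x + f' x) / 2 := fun x => by simp [hk]; ring
  have hkR : k ∈ Icc lo hi := (hmem _).2 fun x => by
    rw [kx]; constructor <;> linarith [(f1 x).1, (f1 x).2, (f1' x).1, (f1' x).2]
  have Fk : F k = m := by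
    ext x
    have h1 : |F k x - F f x| ≤ ρ := hF.abs_apply_sub_le hkR hf (fun y => by
      rw [kx, abs_le]
      have := f1 y
      have := f1' y
      rcases hlh y with h | h <;> constructor <;> linarith) x
    have h2 : |F k x - F f' x| ≤ ρ := hF.abs_apply_sub_le hkR hf' (fun y => by
      rw [kx, abs_le]
      have := f1 y
      have := f1' y
      rcases hlh y with h | h <;> constructor <;> linarith) x
    have h3 := (hmem _).1 (hbij.mapsTo hkR) x
    rw [hfe, abs_le] at h1
    rw [hfe', abs_le, ex'] at h2
    rw [mx]
    rcases hlh x with h | h <;> rcases he x with h' | h' <;> rw [h'] at h1 h2 <;> linarith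
  have hkm : k = m := hbij.injOn hkR hmm (Fk.trans Fm.symm)
  have hfe2 : f = e := by
    ext x
    have h1 := ContinuousMap.le_def.1 (hle f hf) x
    have h2 := ContinuousMap.le_def.1 (hle f' hf') x
    rw [hfe] at h1
    rw [hfe', ex'] at h2
    have h3 : k x = m x := by rw [hkm]
    rw [kx, mx] at h3
    linarith
  rw [← hfe2, hfe, hfe2]

/-- Comparison with the corners shows that a decreasing non-expansive bijection of a box does not
push a value below the centre. -/
theorem min_midpoint_le_apply [T2Space K] [TotallyDisconnectedSpace K]
    (hlh : ∀ x, hi x = lo x ∨ hi x = lo x + 2 * ρ) (hρ : 0 ≤ ρ)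
    (hbij : BijOn F (Icc lo hi) (Icc lo hi)) (hF : LipschitzOnWith 1 F (Icc lo hi))
    (hle : ∀ f ∈ Icc lo hi, F f ≤ f) {f : C(K, ℝ)} (hf : f ∈ Icc lo hi) (a : K) :
    min (f a) ((lo a + hi a) / 2) ≤ F f a := by
  have hmem : ∀ f : C(K, ℝ), f ∈ Icc lo hi ↔ ∀ x, lo x ≤ f x ∧ f x ≤ hi x := fun f => by
    simp only [mem_Icc, ContinuousMap.le_def, forall_and]
  have hlohi : ∀ x, lo x ≤ hi x := fun x => by rcases hlh x with h | h <;> linarith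
  rcases hlh a with ha | ha
  · have h1 := (hmem _).1 hf a
    have h2 := (hmem _).1 (hbij.mapsTo hf) a
    exact (min_le_left _ _).trans (by linarith)
  refine le_of_forall_pos_le_add fun ε hε => ?_
  set m : C(K, ℝ) := (1 / 2 : ℝ) • (lo + hi) with hm
  have mx : ∀ x, m x = (lo x + hi x) / 2 := fun x => by simp [hm]; ring
  set s : ℝ := min (f a - m a) 0 with hs
  have hs0 : s ≤ 0 := min_le_right _ _
  obtain ⟨W, hW, hW1, hW2⟩ := exists_isClopen_between_levels (f - m) (sub_lt_self s hε)
  set e := clopenGlue hW hi lo with he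
  have hcorner : ∀ x, e x = lo x ∨ e x = hi x := fun x => by
    by_cases hx : x ∈ W
    · exact Or.inr (clopenGlue_of_mem hW _ _ hx)
    · exact Or.inl (clopenGlue_of_notMem hW _ _ hx)
  have heR : e ∈ Icc lo hi := (hmem _).2 fun x => by
    rcases hcorner x with h | h <;> simp [h, hlohi x]
  have key : ∀ x, |f x - e x| ≤ ρ - s + ε := fun x => by
    have hfx := (hmem _).1 hf x
    rw [abs_le]
    by_cases hx : x ∈ W
    · have h1 := hW2 x hx
      rw [ContinuousMap.sub_apply, mx] at h1
      rw [he, clopenGlue_of_mem hW _ _ hx]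
      rcases hlh x with h | h <;> constructor <;> linarith
    · have h1 : f x - m x < s := by
        by_contra h
        exact hx (hW1 x (not_lt.1 h))
      rw [mx] at h1
      rw [he, clopenGlue_of_notMem hW _ _ hx]
      rcases hlh x with h | h <;> constructor <;> linarith
  have haW : a ∈ W := hW1 a (min_le_left _ _)
  have h1 := hF.abs_apply_sub_le hf heR key a
  rw [apply_corner_eq_self hlh hρ hbij hF hle hcorner, he, clopenGlue_of_mem hW _ _ haW,
    abs_le] at h1
  have h2 : min (f a) ((lo a + hi a) / 2) = s + m a := by
    rw [hs, ← min_add_add_right, mx]; simp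
  rw [h2, mx]
  linarith

end Box

/-! ### Non-expansive bijections fixing all sign functions -/

section FixSigns

variable {F : C(K, ℝ) → C(K, ℝ)}

theorem le_apply_of_forall_le (hF : LipschitzOnWith 1 F (closedBall 0 1))
    (hfix : ∀ e, IsSign e → F e = e) {f : C(K, ℝ)} (hf : f ∈ closedBall (0 : C(K, ℝ)) 1) {t : ℝ}
    (ht : ∀ x, t ≤ f x) (x : K) : t ≤ F f x := by
  have h1 := hF.abs_apply_sub_le hf IsSign.one.mem_unitBall (r := 1 - t) (fun y => by
    have := abs_le.1 (mem_unitBall_iff.1 hf y)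
    have := ht y
    rw [ContinuousMap.one_apply, abs_le]
    constructor <;> linarith) x
  rw [hfix _ IsSign.one, ContinuousMap.one_apply, abs_le] at h1
  linarith

variable [T2Space K] [TotallyDisconnectedSpace K]

theorem apply_le_max_zero (hF : LipschitzOnWith 1 F (closedBall 0 1))
    (hfix : ∀ e, IsSign e → F e = e) {f : C(K, ℝ)} (hf : f ∈ closedBall (0 : C(K, ℝ)) 1)
    (x : K) : F f x ≤ max (f x) 0 := by
  refine le_of_forall_pos_le_add fun ε hε => ?_
  set s := max (f x) 0 with hs
  have hs0 : 0 ≤ s := le_max_right _ _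
  obtain ⟨U, hU, hU1, hU2⟩ := exists_isClopen_between_levels f (lt_add_of_pos_right s hε)
  have hsign := isSign_clopenGlue hU
  have hx : x ∉ U := fun h => (hU2 x h).not_ge (le_max_left _ _)
  have key : ∀ y, |f y - clopenGlue hU 1 (-1) y| ≤ 1 + s + ε := fun y => by
    have hfy := abs_le.1 (mem_unitBall_iff.1 hf y)
    rw [abs_le]
    by_cases hy : y ∈ U
    · have := hU2 y hy
      rw [clopenGlue_of_mem hU _ _ hy, ContinuousMap.one_apply]
      constructor <;> linarith
    · have : f y < s + ε := by
        by_contra h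
        exact hy (hU1 y (not_lt.1 h))
      rw [clopenGlue_of_notMem hU _ _ hy, ContinuousMap.neg_apply, ContinuousMap.one_apply]
      constructor <;> linarith
  have h1 := hF.abs_apply_sub_le hf hsign.mem_unitBall key x
  rw [hfix _ hsign, clopenGlue_of_notMem hU _ _ hx, ContinuousMap.neg_apply,
    ContinuousMap.one_apply, abs_le] at h1
  linarith

/-- If values up to the level `c` are not decreased, then the box of functions that agree with `f`
on `U` and take values in `[c₀, 1]` off `U` is mapped onto itself, so that values up to the level
`(1 + c₀) / 2` of `f` are not decreased either. -/
theorem min_le_apply_of_min_le_apply (hbij : BijOn F (closedBall 0 1) (closedBall 0 1))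
    (hF : LipschitzOnWith 1 F (closedBall 0 1)) (hfix : ∀ e, IsSign e → F e = e)
    {t c c₀ : ℝ} (ht : 0 < t) (htc : t ≤ c₀) (hc : c₀ ≤ c) (hc1 : c₀ ≤ 1)
    (hP : ∀ g ∈ closedBall (0 : C(K, ℝ)) 1, (∀ x, t ≤ g x) → ∀ x, min (g x) c ≤ F g x)
    {f : C(K, ℝ)} (hf : f ∈ closedBall (0 : C(K, ℝ)) 1) (hft : ∀ x, t ≤ f x)
    {U : Set K} (hU : IsClopen U) (hU1 : ∀ x ∈ U, f x < c) (hU2 : ∀ x, x ∉ U → c₀ ≤ f x)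
    (a : K) : min (f a) ((1 + c₀) / 2) ≤ F f a := by
  set lo := clopenGlue hU f (ContinuousMap.const K c₀) with hlo
  set hi := clopenGlue hU f 1 with hhi
  have hmem : ∀ g : C(K, ℝ), g ∈ Icc lo hi ↔
      (∀ x ∈ U, g x = f x) ∧ ∀ x, x ∉ U → c₀ ≤ g x ∧ g x ≤ 1 := fun g => by
    simp only [mem_Icc, ContinuousMap.le_def, ← forall_and]
    refine forall_congr' fun x => ?_
    by_cases hx : x ∈ U
    · simp only [hlo, hhi, clopenGlue_of_mem hU _ _ hx, hx, not_true_eq_false, forall_const,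
        IsEmpty.forall_iff, and_true]
      exact ⟨fun h => le_antisymm h.2 h.1, fun h => ⟨h.ge, h.le⟩⟩
    · simp [hlo, hhi, clopenGlue_of_notMem hU _ _ hx, hx]
  have hfabs := fun x => abs_le.1 (mem_unitBall_iff.1 hf x)
  have hball : Icc lo hi ⊆ closedBall 0 1 := fun g hg => mem_unitBall_iff.2 fun x => by
    by_cases hx : x ∈ U
    · rw [((hmem g).1 hg).1 x hx]
      exact mem_unitBall_iff.1 hf x
    · have := ((hmem g).1 hg).2 x hx
      exact abs_le.2 ⟨by linarith, this.2⟩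
  have hge : ∀ g ∈ Icc lo hi, ∀ x, t ≤ g x := fun g hg x => by
    by_cases hx : x ∈ U
    · rw [((hmem g).1 hg).1 x hx]
      exact hft x
    · exact htc.trans (((hmem g).1 hg).2 x hx).1
  have hle : ∀ g ∈ Icc lo hi, ∀ x, F g x ≤ g x := fun g hg x => by
    have := apply_le_max_zero hF hfix (hball hg) x
    rwa [max_eq_left (ht.le.trans (hge g hg x))] at this
  have hmaps : MapsTo F (Icc lo hi) (Icc lo hi) := fun g hg => by
    have hg' := (hmem g).1 hg
    have hPg := hP g (hball hg) (hge g hg)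
    refine (hmem _).2 ⟨fun x hx => ?_, fun x hx => ⟨?_, (hle g hg x).trans (hg'.2 x hx).2⟩⟩
    · have h1 := hPg x
      have h2 := hle g hg x
      rw [hg'.1 x hx] at h1 h2
      rw [min_eq_left (hU1 x hx).le] at h1
      exact le_antisymm h2 h1
    · exact (le_min (hg'.2 x hx).1 hc).trans (hPg x)
  have hsurj : SurjOn F (Icc lo hi) (Icc lo hi) := fun g hg => by
    have hg' := (hmem g).1 hg
    obtain ⟨k, hk, hkg⟩ := hbij.surjOn (hball hg)
    have hgk : ∀ x, g x ≤ k x := fun x => by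
      have := apply_le_max_zero hF hfix hk x
      rw [hkg] at this
      exact (le_max_iff.1 this).resolve_right (not_le.2 (ht.trans_le (hge g hg x)))
    have hPk := hP k hk fun x => (hge g hg x).trans (hgk x)
    refine ⟨k, (hmem _).2 ⟨fun x hx => ?_, fun x hx => ⟨(hg'.2 x hx).1.trans (hgk x), ?_⟩⟩, hkg⟩
    · have h1 := hPk x
      have h2 := hgk x
      rw [hkg, hg'.1 x hx] at h1
      rw [hg'.1 x hx] at h2
      exact le_antisymm ((min_le_iff.1 h1).resolve_right (not_le.2 (hU1 x hx))) h2
    · exact (abs_le.1 (mem_unitBall_iff.1 hk x)).2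
  have hfR : f ∈ Icc lo hi := (hmem f).2 ⟨fun _ _ => rfl, fun x hx => ⟨hU2 x hx, (hfabs x).2⟩⟩
  by_cases ha : a ∈ U
  · refine (min_le_left _ _).trans ?_
    have := hP f hf hft a
    rwa [min_eq_left (hU1 a ha).le] at this
  · have := min_midpoint_le_apply (ρ := (1 - c₀) / 2) (lo := lo) (hi := hi) (F := F) (fun x => by
        by_cases hx : x ∈ U
        · exact Or.inl (by rw [hlo, hhi, clopenGlue_of_mem hU _ _ hx, clopenGlue_of_mem hU _ _ hx])
        · refine Or.inr ?_
          rw [hlo, hhi, clopenGlue_of_notMem hU _ _ hx, clopenGlue_of_notMem hU _ _ hx,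
            ContinuousMap.one_apply, ContinuousMap.const_apply]
          ring) (by linarith) ⟨hmaps, hbij.injOn.mono hball, hsurj⟩ (hF.mono hball)
      (fun g hg => ContinuousMap.le_def.2 (hle g hg)) hfR a
    rw [hlo, hhi, clopenGlue_of_notMem hU _ _ ha, clopenGlue_of_notMem hU _ _ ha] at this
    simpa [add_comm] using this

theorem apply_eq_self_of_pos (hbij : BijOn F (closedBall 0 1) (closedBall 0 1))
    (hF : LipschitzOnWith 1 F (closedBall 0 1)) (hfix : ∀ e, IsSign e → F e = e)
    {f : C(K, ℝ)} (hf : f ∈ closedBall (0 : C(K, ℝ)) 1) (hpos : ∀ x, 0 < f x) : F f = f := by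
  ext a
  obtain ⟨b, -, hb⟩ := isCompact_univ.exists_isMinOn ⟨a, mem_univ a⟩ f.continuous.continuousOn
  set t := f b with htdef
  have hft : ∀ x, t ≤ f x := fun x => hb (mem_univ x)
  have ht : 0 < t := hpos b
  have ht1 : t ≤ 1 := (abs_le.1 (mem_unitBall_iff.1 hf b)).2
  let S : Set ℝ := {c | ∀ g ∈ closedBall (0 : C(K, ℝ)) 1, (∀ x, t ≤ g x) →
    ∀ x, min (g x) c ≤ F g x} ∩ Icc t 1
  have hSclosed : IsClosed S := by
    refine IsClosed.inter ?_ isClosed_Icc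
    simp only [ofPred_forall]
    refine isClosed_iInter fun g => isClosed_iInter fun _ => isClosed_iInter fun _ =>
      isClosed_iInter fun x => isClosed_le (by fun_prop) continuous_const
  have hSne : S.Nonempty := ⟨t, fun g hg hgt x => (min_le_right _ _).trans
    (le_apply_of_forall_le hF hfix hg hgt x), le_rfl, ht1⟩
  have hSbdd : BddAbove S := ⟨1, fun c hc => hc.2.2⟩
  obtain ⟨hP, htc, hc1⟩ := hSclosed.csSup_mem hSne hSbdd
  set c := sSup S with hc
  have hc_eq : c = 1 := by
    by_contra hne
    have hlt : c < 1 := lt_of_le_of_ne hc1 hne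
    -- A level `c₀ ≤ c` with `(1 + c₀) / 2 > c`; it equals `c` only if `c = t`.
    set c₀ := max t ((3 * c - 1) / 2) with hc₀
    have h1 : c₀ ≤ c := max_le htc (by linarith)
    have h2 : (3 * c - 1) / 2 ≤ c₀ := le_max_right _ _
    have hmem : (1 + c₀) / 2 ∈ S := by
      refine ⟨fun g hg hgt x => ?_, by linarith [le_max_left t ((3 * c - 1) / 2)], by linarith⟩
      obtain ⟨U, hU, hU1, hU2⟩ : ∃ U : Set K, IsClopen U ∧ (∀ x ∈ U, g x < c) ∧
          ∀ x, x ∉ U → c₀ ≤ g x := by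
        rcases htc.eq_or_lt with htc' | htc'
        · refine ⟨∅, isClopen_empty, by simp, fun x _ => ?_⟩
          have : c₀ ≤ t := htc' ▸ h1
          exact this.trans (hgt x)
        · obtain ⟨V, hV, hV1, hV2⟩ := exists_isClopen_between_levels g
            (max_lt htc' (by linarith) : c₀ < c)
          exact ⟨Vᶜ, hV.compl, fun x hx => by_contra fun h => hx (hV1 x (not_lt.1 h)),
            fun x hx => (hV2 x (not_not.1 hx)).le⟩
      exact min_le_apply_of_min_le_apply hbij hF hfix ht (le_max_left _ _) h1 (h1.trans hc1) hP
        hg hgt hU hU1 hU2 x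
    have := le_csSup hSbdd hmem
    linarith
  rw [hc_eq] at hP
  have h1 := hP f hf hft a
  rw [min_eq_left (abs_le.1 (mem_unitBall_iff.1 hf a)).2] at h1
  have h2 := apply_le_max_zero hF hfix hf a
  rw [max_eq_left (hpos a).le] at h2
  exact le_antisymm h2 h1

theorem apply_eq_self_of_ne_zero (hbij : BijOn F (closedBall 0 1) (closedBall 0 1))
    (hF : LipschitzOnWith 1 F (closedBall 0 1)) (hfix : ∀ e, IsSign e → F e = e)
    {f : C(K, ℝ)} (hf : f ∈ closedBall (0 : C(K, ℝ)) 1) (h0 : ∀ x, f x ≠ 0) : F f = f := by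
  have hU : IsClopen {x | 0 < f x} := by
    refine ⟨?_, isOpen_lt continuous_const f.continuous⟩
    have : {x | 0 < f x} = {x | 0 ≤ f x} := by
      ext x
      simp only [mem_ofPred_eq]
      exact ⟨le_of_lt, fun h => lt_of_le_of_ne h (h0 x).symm⟩
    rw [this]
    exact isClosed_le continuous_const f.continuous
  have he := isSign_clopenGlue hU
  have hef : ∀ x, 0 < (clopenGlue hU 1 (-1) * f) x := fun x => by
    by_cases hx : 0 < f x
    · rw [ContinuousMap.mul_apply, clopenGlue_of_mem hU _ _ hx]
      simpa using hx
    · rw [ContinuousMap.mul_apply, clopenGlue_of_notMem hU _ _ hx]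
      simpa using lt_of_le_of_ne (not_lt.1 hx) (h0 x)
  generalize clopenGlue hU 1 (-1) = e at he hef
  have hee : ∀ g : C(K, ℝ), e * (e * g) = g := fun g => by
    rw [← mul_assoc, he.mul_self, one_mul]
  have hb := bijOn_sign_mul he
  have hlip : LipschitzOnWith 1 (fun g => e * F (e * g)) (closedBall 0 1) := by
    have hmul : ∀ g h : C(K, ℝ), dist (e * g) (e * h) ≤ dist g h := fun g h =>
      (ContinuousMap.dist_le dist_nonneg).2 fun x => by
        rw [Real.dist_eq, ContinuousMap.mul_apply, ContinuousMap.mul_apply, ← mul_sub, abs_mul,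
          he.abs_apply, one_mul]
        exact ContinuousMap.dist_apply_le_dist (f := g) (g := h) x
    refine LipschitzOnWith.of_dist_le_mul fun g hg h hh => ?_
    refine (hmul _ _).trans ((hF.dist_le_mul _ (hb.mapsTo hg) _ (hb.mapsTo hh)).trans ?_)
    simpa using hmul g h
  have hfix' : ∀ e', IsSign e' → e * F (e * e') = e' := fun e' he' => by
    rw [hfix (e * e') fun x => ?_, hee]
    rcases he x with h | h <;> rcases he' x with h' | h' <;> simp [h, h']
  have := apply_eq_self_of_pos (F := fun g => e * F (e * g)) (hb.comp (hbij.comp hb)) hlip hfix'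
    (hb.mapsTo hf) hef
  simp only [hee] at this
  rw [← hee (F f), this, hee]

theorem apply_eq_self_of_forall_isSign (hbij : BijOn F (closedBall 0 1) (closedBall 0 1))
    (hF : LipschitzOnWith 1 F (closedBall 0 1)) (hfix : ∀ e, IsSign e → F e = e)
    {f : C(K, ℝ)} (hf : f ∈ closedBall (0 : C(K, ℝ)) 1) : F f = f := by
  ext x
  refine eq_of_forall_dist_le fun δ hδ => ?_
  rw [Real.dist_eq]
  -- `f` is within `2 ε` of a function of modulus at least `ε`.
  obtain ⟨ε, hε, hε1, hεδ⟩ : ∃ ε : ℝ, 0 < ε ∧ ε ≤ 1 ∧ 4 * ε ≤ δ :=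
    ⟨min 1 (δ / 4), by positivity, min_le_left _ _, by linarith [min_le_right 1 (δ / 4)]⟩
  obtain ⟨U, hU, hU1, hU2⟩ := exists_isClopen_between_levels f (neg_lt_zero.2 hε)
  set g := clopenGlue hU (f ⊔ ContinuousMap.const K ε) (f ⊓ ContinuousMap.const K (-ε)) with hg
  have hg1 : ∀ y, y ∈ U → g y = max (f y) ε := fun y hy => by
    simp [hg, clopenGlue_of_mem hU _ _ hy]
  have hg2 : ∀ y, y ∉ U → g y = min (f y) (-ε) := fun y hy => by
    simp [hg, clopenGlue_of_notMem hU _ _ hy]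
  have hfabs := fun y => abs_le.1 (mem_unitBall_iff.1 hf y)
  have hgB : g ∈ closedBall (0 : C(K, ℝ)) 1 := mem_unitBall_iff.2 fun y => by
    rw [abs_le]
    by_cases hy : y ∈ U
    · rw [hg1 y hy]
      exact ⟨le_max_of_le_left (hfabs y).1, max_le (hfabs y).2 hε1⟩
    · rw [hg2 y hy]
      exact ⟨le_min (hfabs y).1 (by linarith), min_le_of_left_le (hfabs y).2⟩
  have hg0 : ∀ y, g y ≠ 0 := fun y => by
    by_cases hy : y ∈ U
    · rw [hg1 y hy]
      exact (lt_max_of_lt_right hε).ne'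
    · rw [hg2 y hy]
      exact (min_lt_of_right_lt (neg_lt_zero.2 hε)).ne
  have hfg : ∀ y, |f y - g y| ≤ 2 * ε := fun y => by
    rw [abs_le]
    by_cases hy : y ∈ U
    · have := hU2 y hy
      rw [hg1 y hy]
      rcases max_cases (f y) ε with h | h <;> constructor <;> linarith
    · have : f y < 0 := by
        by_contra h
        exact hy (hU1 y (not_lt.1 h))
      rw [hg2 y hy]
      rcases min_cases (f y) (-ε) with h | h <;> constructor <;> linarith
  have h1 := hF.abs_apply_sub_le hf hgB hfg x
  rw [apply_eq_self_of_ne_zero hbij hF hfix hgB hg0] at h1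
  have h2 := hfg x
  rw [abs_le] at h1 h2 ⊢
  constructor <;> linarith

end FixSigns

/-! ### Preimages of sign functions -/

section Preimage

variable {F : C(K, ℝ) → C(K, ℝ)}

theorem apply_zero_eq_zero (hbij : BijOn F (closedBall 0 1) (closedBall 0 1))
    (hF : LipschitzOnWith 1 F (closedBall 0 1)) : F 0 = 0 := by
  have h0 : (0 : C(K, ℝ)) ∈ closedBall (0 : C(K, ℝ)) 1 := mem_closedBall_self zero_le_one
  have key : ∀ e : C(K, ℝ), IsSign e → ∀ x, |e x - F 0 x| ≤ 1 := fun e he x => by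
    obtain ⟨f, hf, hfe⟩ := hbij.surjOn he.mem_unitBall
    rw [← hfe]
    exact hF.abs_apply_sub_le hf h0 (fun y => by simpa using mem_unitBall_iff.1 hf y) x
  ext x
  have h1 := abs_le.1 (key 1 IsSign.one x)
  have h2 := abs_le.1 (key (-1) IsSign.one.neg x)
  simp only [ContinuousMap.neg_apply, ContinuousMap.one_apply] at h1 h2
  rw [ContinuousMap.zero_apply]
  linarith

/-- Preimages of sign functions are sign functions: with `d = 1 - |f|`, the images of `(f + d) / 2`
and of `(f - d) / 2` are both within `1 / 2` of `0` and of `F f`, hence both equal to `F f / 2`. -/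
theorem isSign_of_isSign_apply (hbij : BijOn F (closedBall 0 1) (closedBall 0 1))
    (hF : LipschitzOnWith 1 F (closedBall 0 1)) {f : C(K, ℝ)}
    (hf : f ∈ closedBall (0 : C(K, ℝ)) 1) (he : IsSign (F f)) : IsSign f := by
  have h0 : (0 : C(K, ℝ)) ∈ closedBall (0 : C(K, ℝ)) 1 := mem_closedBall_self zero_le_one
  have hfx := mem_unitBall_iff.1 hf
  have key : ∀ k : C(K, ℝ), (∀ x, |k x| ≤ 1 / 2) → (∀ x, |k x - f x| ≤ 1 / 2) →
      F k = (1 / 2 : ℝ) • F f := fun k hk hkf => by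
    have hkB : k ∈ closedBall (0 : C(K, ℝ)) 1 := mem_unitBall_iff.2 fun x => by linarith [hk x]
    ext x
    have h1 := hF.abs_apply_sub_le hkB h0 (r := 1 / 2) (by simpa using hk) x
    have h2 := hF.abs_apply_sub_le hkB hf hkf x
    rw [apply_zero_eq_zero hbij hF, ContinuousMap.zero_apply, abs_le] at h1
    rw [abs_le] at h2
    rw [ContinuousMap.smul_apply, smul_eq_mul]
    rcases he x with h | h <;> rw [h] at h2 ⊢ <;> linarith
  set k : C(K, ℝ) := (1 / 2 : ℝ) • (f + (1 - |f|)) with hk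
  set k' : C(K, ℝ) := (1 / 2 : ℝ) • (f - (1 - |f|)) with hk'
  have kx : ∀ x, k x = (f x + (1 - |f x|)) / 2 := fun x => by simp [hk]; ring
  have kx' : ∀ x, k' x = (f x - (1 - |f x|)) / 2 := fun x => by simp [hk']; ring
  have b1 : ∀ x, |k x| ≤ 1 / 2 := fun x => by
    have := hfx x
    rw [kx, abs_le]
    rcases abs_cases (f x) with h | h <;> constructor <;> linarith
  have b2 : ∀ x, |k' x| ≤ 1 / 2 := fun x => by
    have := hfx x
    rw [kx', abs_le]
    rcases abs_cases (f x) with h | h <;> constructor <;> linarith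
  have c1 : ∀ x, |k x - f x| ≤ 1 / 2 := fun x => by
    have := hfx x
    rw [kx, abs_le]
    rcases abs_cases (f x) with h | h <;> constructor <;> linarith
  have c2 : ∀ x, |k' x - f x| ≤ 1 / 2 := fun x => by
    have := hfx x
    rw [kx', abs_le]
    rcases abs_cases (f x) with h | h <;> constructor <;> linarith
  have hkk : k = k' := hbij.injOn (mem_unitBall_iff.2 fun x => by linarith [b1 x])
    (mem_unitBall_iff.2 fun x => by linarith [b2 x]) ((key k b1 c1).trans (key k' b2 c2).symm)
  intro x
  have h1 : k x = k' x := by rw [hkk]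
  rw [kx, kx'] at h1
  have h2 : |f x| = 1 := by linarith
  exact eq_or_eq_neg_of_abs_eq h2

/-- The midpoint of the preimages of two antipodal sign functions is sent to `0`. -/
theorem eq_neg_of_apply_eq_neg (hbij : BijOn F (closedBall 0 1) (closedBall 0 1))
    (hF : LipschitzOnWith 1 F (closedBall 0 1)) {f f' : C(K, ℝ)}
    (hf : f ∈ closedBall (0 : C(K, ℝ)) 1) (hf' : f' ∈ closedBall (0 : C(K, ℝ)) 1)
    (he : IsSign (F f)) (h : F f' = -F f) : f' = -f := by
  have h0 : (0 : C(K, ℝ)) ∈ closedBall (0 : C(K, ℝ)) 1 := mem_closedBall_self zero_le_one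
  have hfx := fun x => abs_le.1 (mem_unitBall_iff.1 hf x)
  have hfx' := fun x => abs_le.1 (mem_unitBall_iff.1 hf' x)
  set k : C(K, ℝ) := (1 / 2 : ℝ) • (f + f') with hk
  have kx : ∀ x, k x = (f x + f' x) / 2 := fun x => by simp [hk]; ring
  have hkB : k ∈ closedBall (0 : C(K, ℝ)) 1 := mem_unitBall_iff.2 fun x => by
    rw [kx, abs_le]
    constructor <;> linarith [hfx x, hfx' x]
  have hk0 : F k = F 0 := by
    rw [apply_zero_eq_zero hbij hF]
    ext x
    have h1 := hF.abs_apply_sub_le hkB hf (r := 1) (fun y => by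
      rw [kx, abs_le]
      constructor <;> linarith [hfx y, hfx' y]) x
    have h2 := hF.abs_apply_sub_le hkB hf' (r := 1) (fun y => by
      rw [kx, abs_le]
      constructor <;> linarith [hfx y, hfx' y]) x
    rw [h, ContinuousMap.neg_apply] at h2
    rw [abs_le] at h1 h2
    rw [ContinuousMap.zero_apply]
    rcases he x with h' | h' <;> rw [h'] at h1 h2 <;> linarith
  have hk1 : k = 0 := hbij.injOn hkB h0 hk0
  ext x
  have h1 : k x = 0 := by rw [hk1, ContinuousMap.zero_apply]
  rw [kx] at h1
  rw [ContinuousMap.neg_apply]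
  linarith

end Preimage

/-! ### The point map induced on `K` -/

section PointMap

variable [T2Space K] {F G : C(K, ℝ) → C(K, ℝ)}

theorem spike_mem_unitBall {a : K} (ha : IsOpen ({a} : Set K)) {ω : ℝ} (hω : |ω| ≤ 1) :
    spike ha ω ∈ closedBall (0 : C(K, ℝ)) 1 := mem_unitBall_iff.2 fun x => by
  by_cases hx : x = a
  · rw [hx, spike_self]
    exact hω
  · simp [spike_of_ne ha ω hx]

/-- For a sign function `e` with preimage `G e`, the signs of `G e` at `a` and of `e` at a point `b`
of the support of `F (ω 𝟙_{a})` determine each other, since `ω 𝟙_{a}` is at distance `1` from each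
sign function that takes the value `ω` at `a`. -/
theorem preimage_mul_apply_spike_pos (hF : LipschitzOnWith 1 F (closedBall 0 1))
    (hG : ∀ e, IsSign e → IsSign (G e) ∧ F (G e) = e) (hGneg : ∀ e, IsSign e → G (-e) = -G e)
    {a b : K} (ha : IsOpen ({a} : Set K)) {ω : ℝ} (hω : ω = 1 ∨ ω = -1)
    (hb : F (spike ha ω) b ≠ 0) {e : C(K, ℝ)} (he : IsSign e) :
    0 < G e a * ω * (e b * F (spike ha ω) b) := by
  have hω1 : |ω| ≤ 1 := by rcases hω with h | h <;> simp [h]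
  have key : ∀ e, IsSign e → G e a = ω → 0 < e b * F (spike ha ω) b := fun e he hea => by
    have h1 := hF.abs_apply_sub_le (spike_mem_unitBall ha hω1) (hG e he).1.mem_unitBall (r := 1)
      (fun x => by
        by_cases hx : x = a
        · rw [hx, spike_self, hea]
          simp
        · rw [spike_of_ne ha ω hx, zero_sub, abs_neg, (hG e he).1.abs_apply]) b
    rw [(hG e he).2, abs_le] at h1
    have h2 : 0 ≤ e b * F (spike ha ω) b := by
      rcases he b with h | h <;> rw [h] at h1 ⊢ <;> linarith
    refine lt_of_le_of_ne h2 (Ne.symm (mul_ne_zero ?_ hb))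
    rcases he b with h | h <;> simp [h]
  by_cases hea : G e a = ω
  · have h1 := key e he hea
    have h2 : G e a * ω = 1 := by rw [hea]; rcases hω with h | h <;> simp [h]
    rwa [h2, one_mul]
  · have hea' : G e a = -ω := by
      rcases (hG e he).1 a with h | h <;> rcases hω with h' | h' <;> simp_all
    have h1 := key (-e) he.neg (by rw [hGneg e he, ContinuousMap.neg_apply, hea', neg_neg])
    have h2 : G e a * ω = -1 := by rw [hea']; rcases hω with h | h <;> simp [h]
    rw [h2]
    rw [ContinuousMap.neg_apply] at h1
    linarith

theorem preimage_eq_mul_of_apply_spike_ne_zero (hF : LipschitzOnWith 1 F (closedBall 0 1))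
    (hG : ∀ e, IsSign e → IsSign (G e) ∧ F (G e) = e) (hGneg : ∀ e, IsSign e → G (-e) = -G e)
    {a b : K} (ha : IsOpen ({a} : Set K)) {ω : ℝ} (hω : ω = 1 ∨ ω = -1)
    (hb : F (spike ha ω) b ≠ 0) {e : C(K, ℝ)} (he : IsSign e) : G e a = G 1 a * e b := by
  have h1 := preimage_mul_apply_spike_pos hF hG hGneg ha hω hb he
  have h2 := preimage_mul_apply_spike_pos hF hG hGneg ha hω hb IsSign.one
  rw [ContinuousMap.one_apply] at h2
  rcases (hG e he).1 a with h | h <;> rcases (hG 1 IsSign.one).1 a with h' | h' <;>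
    rcases he b with h'' | h'' <;> rcases hω with h3 | h3 <;> rw [h, h''] at h1 <;>
    rw [h'] at h2 <;> rw [h, h', h''] <;> subst h3 <;> first | (exfalso; linarith) | norm_num

theorem apply_spike_ne_zero (hbij : BijOn F (closedBall 0 1) (closedBall 0 1))
    (hF : LipschitzOnWith 1 F (closedBall 0 1)) {a : K} (ha : IsOpen ({a} : Set K)) {ω : ℝ}
    (hω : ω = 1 ∨ ω = -1) : ∃ b, F (spike ha ω) b ≠ 0 := by
  by_contra! h
  have hω1 : |ω| ≤ 1 := by rcases hω with h | h <;> simp [h]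
  have h1 : F (spike ha ω) = F 0 := by
    rw [apply_zero_eq_zero hbij hF]
    ext x
    exact h x
  have h2 := hbij.injOn (spike_mem_unitBall ha hω1) (mem_closedBall_self zero_le_one) h1
  have h3 : ω = 0 := by rw [← spike_self ha ω, h2, ContinuousMap.zero_apply]
  rcases hω with h | h <;> rw [h] at h3 <;> norm_num at h3

/-- The point map exists on isolated points, and the set of points at which it exists is the
projection of a closed subset of `K × K`. -/
theorem exists_pointMap (hbij : BijOn F (closedBall 0 1) (closedBall 0 1))
    (hF : LipschitzOnWith 1 F (closedBall 0 1))
    (hG : ∀ e, IsSign e → IsSign (G e) ∧ F (G e) = e) (hGneg : ∀ e, IsSign e → G (-e) = -G e)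
    (hdense : Dense {a : K | IsOpen ({a} : Set K)}) :
    ∃ σ : K → K, ∀ e, IsSign e → ∀ x, G e x = G 1 x * e (σ x) := by
  have hclosed : IsClosed {p : K × K | ∀ e, IsSign e → G e p.1 = G 1 p.1 * e p.2} := by
    simp only [ofPred_forall]
    exact isClosed_iInter fun e => isClosed_iInter fun _ =>
      isClosed_eq (by fun_prop) (by fun_prop)
  have himage := (hclosed.isCompact.image continuous_fst).isClosed
  have hsub : {a : K | IsOpen ({a} : Set K)} ⊆
      Prod.fst '' {p : K × K | ∀ e, IsSign e → G e p.1 = G 1 p.1 * e p.2} := fun a ha => by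
    obtain ⟨b, hb⟩ := apply_spike_ne_zero hbij hF ha (Or.inl rfl)
    exact ⟨(a, b), fun e he =>
      preimage_eq_mul_of_apply_spike_ne_zero hF hG hGneg ha (Or.inl rfl) hb he, rfl⟩
  have hall : ∀ x : K, ∃ y, ∀ e, IsSign e → G e x = G 1 x * e y := fun x => by
    obtain ⟨⟨x', y⟩, hy, rfl⟩ := himage.closure_subset_iff.2 hsub (hdense x)
    exact ⟨y, hy⟩
  choose σ hσ using hall
  exact ⟨σ, fun e he x => hσ x e he⟩

theorem exists_isSign_apply_eq [TotallyDisconnectedSpace K] {x y : K} (hxy : x ≠ y) :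
    ∃ e : C(K, ℝ), IsSign e ∧ e x = 1 ∧ e y = -1 := by
  obtain ⟨U, hU, h1, h2⟩ := exists_clopen_of_closed_subset_open
    (isClosed_singleton : IsClosed {x}) (isOpen_compl_singleton : IsOpen {y}ᶜ)
    (singleton_subset_iff.2 hxy)
  have hy : y ∉ U := fun h => h2 h rfl
  refine ⟨_, isSign_clopenGlue hU, ?_, ?_⟩
  · rw [clopenGlue_of_mem hU _ _ (h1 rfl), ContinuousMap.one_apply]
  · rw [clopenGlue_of_notMem hU _ _ hy, ContinuousMap.neg_apply, ContinuousMap.one_apply]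

variable {σ : K → K}

theorem continuous_pointMap (hzero : TopologicalSpace.IsTopologicalBasis {U : Set K | IsClopen U})
    (hG : ∀ e, IsSign e → IsSign (G e) ∧ F (G e) = e)
    (hσ : ∀ e, IsSign e → ∀ x, G e x = G 1 x * e (σ x)) : Continuous σ := by
  refine hzero.continuous_iff.2 fun W hW => ?_
  have hW : IsClopen W := hW
  have heq : σ ⁻¹' W = {x | 0 < G 1 x * G (clopenGlue hW 1 (-1)) x} := by
    ext x
    have h1 : G 1 x * G (clopenGlue hW 1 (-1)) x = clopenGlue hW 1 (-1) (σ x) := by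
      rw [hσ _ (isSign_clopenGlue hW) x, ← mul_assoc]
      rcases (hG 1 IsSign.one).1 x with h | h <;> simp [h]
    rw [mem_preimage, mem_ofPred_eq, h1]
    by_cases hx : σ x ∈ W
    · simp [clopenGlue_of_mem hW _ _ hx, hx]
    · simp [clopenGlue_of_notMem hW _ _ hx, hx]
  rw [heq]
  exact isOpen_lt continuous_const (by fun_prop)

/-- A point outside the range of `σ` would have a clopen neighbourhood outside this range, and
changing the sign of `1` there would not change the preimage under `F`. -/
theorem surjective_pointMap [TotallyDisconnectedSpace K]
    (hG : ∀ e, IsSign e → IsSign (G e) ∧ F (G e) = e)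
    (hσ : ∀ e, IsSign e → ∀ x, G e x = G 1 x * e (σ x)) (hcont : Continuous σ) :
    Function.Surjective σ := by
  intro y
  by_contra hy
  obtain ⟨U, hU, h1, h2⟩ := exists_clopen_of_closed_subset_open (isCompact_range hcont).isClosed
    (isOpen_compl_singleton : IsOpen {y}ᶜ) (subset_compl_singleton_iff.2 hy)
  have hyU : y ∉ U := fun h => h2 h rfl
  have he := isSign_clopenGlue hU
  have hGe : G (clopenGlue hU 1 (-1)) = G 1 := by
    ext x
    rw [hσ _ he x, clopenGlue_of_mem hU _ _ (h1 (mem_range_self x)), ContinuousMap.one_apply,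
      mul_one]
  have h3 : clopenGlue hU 1 (-1) = (1 : C(K, ℝ)) := by
    rw [← (hG _ he).2, hGe, (hG 1 IsSign.one).2]
  have h4 : clopenGlue hU 1 (-1) y = (1 : C(K, ℝ)) y := by rw [h3]
  rw [clopenGlue_of_notMem hU _ _ hyU, ContinuousMap.neg_apply, ContinuousMap.one_apply] at h4
  norm_num at h4

theorem apply_spike_of_ne [TotallyDisconnectedSpace K] (hF : LipschitzOnWith 1 F (closedBall 0 1))
    (hG : ∀ e, IsSign e → IsSign (G e) ∧ F (G e) = e) (hGneg : ∀ e, IsSign e → G (-e) = -G e)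
    (hσ : ∀ e, IsSign e → ∀ x, G e x = G 1 x * e (σ x)) {a b : K}
    (ha : IsOpen ({a} : Set K)) {ω : ℝ} (hω : ω = 1 ∨ ω = -1) (hb : b ≠ σ a) :
    F (spike ha ω) b = 0 := by
  by_contra hne
  obtain ⟨e, he, h1, h2⟩ := exists_isSign_apply_eq hb
  have h3 := preimage_eq_mul_of_apply_spike_ne_zero hF hG hGneg ha hω hne he
  rw [hσ e he a, h1, h2] at h3
  rcases (hG 1 IsSign.one).1 a with h | h <;> rw [h] at h3 <;> norm_num at h3

theorem sign_mul_apply_spike_eq_norm [TotallyDisconnectedSpace K]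
    (hbij : BijOn F (closedBall 0 1) (closedBall 0 1))
    (hF : LipschitzOnWith 1 F (closedBall 0 1))
    (hG : ∀ e, IsSign e → IsSign (G e) ∧ F (G e) = e) (hGneg : ∀ e, IsSign e → G (-e) = -G e)
    (hσ : ∀ e, IsSign e → ∀ x, G e x = G 1 x * e (σ x)) {a : K}
    (ha : IsOpen ({a} : Set K)) {ω : ℝ} (hω : ω = 1 ∨ ω = -1) :
    0 < ‖F (spike ha ω)‖ ∧ G 1 a * ω * F (spike ha ω) (σ a) = ‖F (spike ha ω)‖ := by
  obtain ⟨b, hb⟩ := apply_spike_ne_zero hbij hF ha hω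
  have hbσ : b = σ a := by
    by_contra h
    exact hb (apply_spike_of_ne hF hG hGneg hσ ha hω h)
  rw [hbσ] at hb
  have hpos := preimage_mul_apply_spike_pos hF hG hGneg ha hω hb IsSign.one
  rw [ContinuousMap.one_apply, one_mul] at hpos
  have habs : G 1 a * ω * F (spike ha ω) (σ a) = |F (spike ha ω) (σ a)| := by
    rw [← abs_of_pos hpos, abs_mul, abs_mul, (hG 1 IsSign.one).1.abs_apply]
    rcases hω with h | h <;> simp [h]
  have hnorm : ‖F (spike ha ω)‖ = |F (spike ha ω) (σ a)| := by
    refine le_antisymm ((ContinuousMap.norm_le _ (abs_nonneg _)).2 fun x => ?_)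
      ((F (spike ha ω)).norm_coe_le_norm (σ a))
    by_cases hx : x = σ a
    · rw [hx, Real.norm_eq_abs]
    · rw [apply_spike_of_ne hF hG hGneg hσ ha hω hx, norm_zero]
      exact abs_nonneg _
  rw [hnorm]
  exact ⟨abs_pos.2 hb, habs⟩

/-- If the images of the spikes have norms bounded below by some `c > 1 / 2`, then `σ` is injective.
For disjoint clopen `U ∋ u` and `Uᶜ ∋ v`, the function `± G 1 / 2` with sign `+` on `U` and `-` on
`Uᶜ` is within `1 / 2` of spikes at all isolated points, so that its image is at least `c - 1 / 2`
at `σ u` and at most `-(c - 1 / 2)` at `σ v`. -/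
theorem injective_pointMap_of_lt_norm [TotallyDisconnectedSpace K]
    (hbij : BijOn F (closedBall 0 1) (closedBall 0 1))
    (hF : LipschitzOnWith 1 F (closedBall 0 1))
    (hG : ∀ e, IsSign e → IsSign (G e) ∧ F (G e) = e) (hGneg : ∀ e, IsSign e → G (-e) = -G e)
    (hdense : Dense {a : K | IsOpen ({a} : Set K)})
    (hσ : ∀ e, IsSign e → ∀ x, G e x = G 1 x * e (σ x)) (hcont : Continuous σ) {c : ℝ}
    (hc : 1 / 2 < c)
    (hnorm : ∀ (a : K) (ha : IsOpen ({a} : Set K)) (ω : ℝ), ω = 1 ∨ ω = -1 →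
      c ≤ ‖F (spike ha ω)‖) : Function.Injective σ := by
  intro u v huv
  by_contra hne
  obtain ⟨e, he, heu, hev⟩ := exists_isSign_apply_eq hne
  have hS := (hG 1 IsSign.one).1
  set f : C(K, ℝ) := (1 / 2 : ℝ) • (e * G 1) with hf
  have fx : ∀ x, f x = e x * G 1 x / 2 := fun x => by simp [hf]; ring
  have fabs : ∀ x, |f x| = 1 / 2 := fun x => by
    rw [fx, abs_div, abs_mul, he.abs_apply, hS.abs_apply]
    norm_num
  have hfB : f ∈ closedBall (0 : C(K, ℝ)) 1 := mem_unitBall_iff.2 fun x => by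
    rw [fabs]
    norm_num
  have key : ∀ a, IsOpen ({a} : Set K) → c - 1 / 2 ≤ e a * F f (σ a) := fun a ha => by
    have hω : e a * G 1 a = 1 ∨ e a * G 1 a = -1 := by
      rcases he a with h | h <;> rcases hS a with h' | h' <;> simp [h, h']
    have hω1 : |e a * G 1 a| ≤ 1 := by rcases hω with h | h <;> simp [h]
    have h1 := hF.abs_apply_sub_le hfB (spike_mem_unitBall ha hω1) (r := 1 / 2) (fun x => by
      by_cases hx : x = a
      · rw [hx, spike_self, fx]
        rcases hω with h | h <;> rw [h] <;> norm_num
      · rw [spike_of_ne ha _ hx, sub_zero, fabs]) (σ a)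
    have h2 := (sign_mul_apply_spike_eq_norm hbij hF hG hGneg hσ ha hω).2
    have h3 := hnorm a ha _ hω
    rw [abs_le] at h1
    have h4 : G 1 a * (e a * G 1 a) = e a := by
      rcases hS a with h' | h' <;> simp [h']
    rw [h4] at h2
    rcases he a with h | h <;> rw [h] at h1 h2 h3 ⊢ <;> linarith
  have hall : ∀ x, c - 1 / 2 ≤ e x * F f (σ x) := fun x =>
    mem_of_isolated_mem hdense isOpen_univ
      (isClosed_le continuous_const (by fun_prop) : IsClosed {x | c - 1 / 2 ≤ e x * F f (σ x)})
      (fun a _ ha => key a ha) (mem_univ x)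
  have h1 := hall u
  have h2 := hall v
  rw [heu] at h1
  rw [hev, ← huv] at h2
  linarith

/-- Where `F f` has modulus `1` at `σ a`, comparing `f` with the spike at `a` of the sign of `f a`
determines the sign of `F f (σ a)`. -/
theorem sign_mul_apply_nonneg [TotallyDisconnectedSpace K]
    (hbij : BijOn F (closedBall 0 1) (closedBall 0 1))
    (hF : LipschitzOnWith 1 F (closedBall 0 1))
    (hG : ∀ e, IsSign e → IsSign (G e) ∧ F (G e) = e) (hGneg : ∀ e, IsSign e → G (-e) = -G e)
    (hσ : ∀ e, IsSign e → ∀ x, G e x = G 1 x * e (σ x)) {a : K}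
    (ha : IsOpen ({a} : Set K)) {f : C(K, ℝ)} (hf : f ∈ closedBall (0 : C(K, ℝ)) 1)
    (h1 : |F f (σ a)| = 1) : 0 ≤ G 1 a * f a * F f (σ a) := by
  have hS := (hG 1 IsSign.one).1
  have hfx := mem_unitBall_iff.1 hf
  have key : ∀ ω : ℝ, ω = 1 ∨ ω = -1 → 0 ≤ ω * f a → 0 ≤ G 1 a * ω * F f (σ a) :=
    fun ω hω hfa => by
    have hω1 : |ω| ≤ 1 := by rcases hω with h | h <;> simp [h]
    have h2 := hF.abs_apply_sub_le hf (spike_mem_unitBall ha hω1) (r := 1) (fun x => by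
      by_cases hx : x = a
      · have := abs_le.1 (hfx a)
        rw [hx, spike_self, abs_le]
        rcases hω with h | h <;> rw [h] at hfa ⊢ <;> constructor <;> linarith
      · rw [spike_of_ne ha _ hx, sub_zero]
        exact hfx x) (σ a)
    obtain ⟨h3, h4⟩ := sign_mul_apply_spike_eq_norm hbij hF hG hGneg hσ ha hω
    rw [abs_le] at h2
    rcases hS a with h | h <;> rcases hω with h' | h' <;> subst h' <;> rw [h] at h4 ⊢ <;>
      rcases eq_or_eq_neg_of_abs_eq h1 with h'' | h'' <;> rw [h''] at h2 ⊢ <;> linarith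
  rcases le_total 0 (f a) with h | h
  · have := mul_nonneg h (key 1 (Or.inl rfl) (by linarith))
    linarith
  · have := mul_nonneg (neg_nonneg.2 h) (key (-1) (Or.inr rfl) (by linarith))
    linarith

theorem injective_pointMap_of_exists_sign [TotallyDisconnectedSpace K]
    (hbij : BijOn F (closedBall 0 1) (closedBall 0 1))
    (hF : LipschitzOnWith 1 F (closedBall 0 1))
    (hG : ∀ e, IsSign e → IsSign (G e) ∧ F (G e) = e) (hGneg : ∀ e, IsSign e → G (-e) = -G e)
    (hdense : Dense {a : K | IsOpen ({a} : Set K)})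
    (hσ : ∀ e, IsSign e → ∀ x, G e x = G 1 x * e (σ x)) (hcont : Continuous σ)
    (hstar : ∀ u v z : K, u ≠ v → ∀ ω : ℝ, ω = 1 ∨ ω = -1 → ∃ f ∈ closedBall (0 : C(K, ℝ)) 1,
      0 < ω * (f u * f v) ∧ ∀ᶠ x in 𝓝 z, |F f x| = 1) : Function.Injective σ := by
  intro u v huv
  by_contra hne
  have hS := (hG 1 IsSign.one).1
  obtain ⟨f, hf, hsign, hz⟩ := hstar u v (σ u) hne (-(G 1 u * G 1 v)) (by
    rcases hS u with h | h <;> rcases hS v with h' | h' <;> simp [h, h'])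
  obtain ⟨N, hN1, hN, hzN⟩ := eventually_nhds_iff.1 hz
  have hall : ∀ x ∈ σ ⁻¹' N, 0 ≤ G 1 x * f x * F f (σ x) := fun x hx =>
    mem_of_isolated_mem hdense (hN.preimage hcont)
      (isClosed_le continuous_const (by fun_prop) :
        IsClosed {x | 0 ≤ G 1 x * f x * F f (σ x)})
      (fun a haN ha => sign_mul_apply_nonneg hbij hF hG hGneg hσ ha hf (hN1 _ haN)) hx
  have h1 := hall u hzN
  have h2 := hall v (show σ v ∈ N from huv ▸ hzN)
  rw [← huv] at h2
  have h3 := mul_nonneg h1 h2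
  have h4 : F f (σ u) * F f (σ u) = 1 := by
    rw [← abs_mul_abs_self, hN1 _ hzN, one_mul]
  have h5 : G 1 u * f u * F f (σ u) * (G 1 v * f v * F f (σ u)) =
      G 1 u * G 1 v * (f u * f v) * (F f (σ u) * F f (σ u)) := by ring
  rw [h5, h4] at h3
  linarith

/-- If `σ` is injective, then `f ↦ G 1 * (f ∘ σ)` is a surjective isometry of the ball that agrees
with the inverse of `F` at sign functions, hence everywhere. -/
theorem dist_apply_eq_of_injective_pointMap [TotallyDisconnectedSpace K]
    (hbij : BijOn F (closedBall 0 1) (closedBall 0 1))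
    (hF : LipschitzOnWith 1 F (closedBall 0 1))
    (hG : ∀ e, IsSign e → IsSign (G e) ∧ F (G e) = e)
    (hσ : ∀ e, IsSign e → ∀ x, G e x = G 1 x * e (σ x)) (hcont : Continuous σ)
    (hinj : Function.Injective σ) {f g : C(K, ℝ)} (hf : f ∈ closedBall (0 : C(K, ℝ)) 1)
    (hg : g ∈ closedBall (0 : C(K, ℝ)) 1) : dist (F f) (F g) = dist f g := by
  have hS := (hG 1 IsSign.one).1
  have hsurj := surjective_pointMap hG hσ hcont
  let s : C(K, K) := ⟨σ, hcont⟩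
  let T : C(K, ℝ) → C(K, ℝ) := fun f => G 1 * f.comp s
  have hTisom : ∀ f g, dist (T f) (T g) = dist f g := fun f g => by
    have hx : ∀ x, dist (T f x) (T g x) = dist (f (σ x)) (g (σ x)) := fun x => by
      change |G 1 x * f (σ x) - G 1 x * g (σ x)| = |f (σ x) - g (σ x)|
      rw [← mul_sub, abs_mul, hS.abs_apply, one_mul]
    refine le_antisymm ((ContinuousMap.dist_le dist_nonneg).2 fun x => ?_)
      ((ContinuousMap.dist_le dist_nonneg).2 fun y => ?_)
    · rw [hx]
      exact ContinuousMap.dist_apply_le_dist _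
    · obtain ⟨x, rfl⟩ := hsurj y
      rw [← hx]
      exact ContinuousMap.dist_apply_le_dist _
  have hTcomp : BijOn (fun f : C(K, ℝ) => f.comp s) (closedBall (0 : C(K, ℝ)) 1)
      (closedBall (0 : C(K, ℝ)) 1) := by
    refine ⟨fun f hf => mem_unitBall_iff.2 fun x => mem_unitBall_iff.1 hf (σ x),
      fun f _ g _ hfg => ?_, fun g hg => ?_⟩
    · ext y
      obtain ⟨x, rfl⟩ := hsurj y
      exact DFunLike.congr_fun hfg x
    · let e : K ≃ₜ K := Continuous.homeoOfEquivCompactToT2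
        (f := Equiv.ofBijective σ ⟨hinj, hsurj⟩) hcont
      refine ⟨g.comp ⟨e.symm, e.symm.continuous⟩,
        mem_unitBall_iff.2 fun x => mem_unitBall_iff.1 hg _, ?_⟩
      ext x
      exact congrArg g (e.symm_apply_apply x)
  have hT : BijOn T (closedBall 0 1) (closedBall 0 1) := (bijOn_sign_mul hS).comp hTcomp
  have hlip : LipschitzOnWith 1 (F ∘ T) (closedBall 0 1) := by
    refine LipschitzOnWith.of_dist_le_mul fun f hf g hg => ?_
    rw [← hTisom f g]
    exact hF.dist_le_mul _ (hT.mapsTo hf) _ (hT.mapsTo hg)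
  have hfix : ∀ e, IsSign e → (F ∘ T) e = e := fun e he => by
    have : T e = G e := by
      ext x
      exact (hσ e he x).symm
    rw [Function.comp_apply, this, (hG e he).2]
  obtain ⟨f', hf', rfl⟩ := hT.surjOn hf
  obtain ⟨g', hg', rfl⟩ := hT.surjOn hg
  have h1 := apply_eq_self_of_forall_isSign (hbij.comp hT) hlip hfix hf'
  have h2 := apply_eq_self_of_forall_isSign (hbij.comp hT) hlip hfix hg'
  rw [Function.comp_apply] at h1 h2
  rw [h1, h2, hTisom]

end PointMap

end Plasticity

theorem theorem5p1 {K : Type*} [TopologicalSpace K] [CompactSpace K] [T2Space K]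
    (hzero : TopologicalSpace.IsTopologicalBasis {U : Set K | IsClopen U})
    (hdense : Dense (accPoints K)ᶜ)
    (hGδ : IsGδ (accPoints K))
    (F : UnitBall K → UnitBall K)
    (hbij : Function.Bijective F)
    (hF : LipschitzWith 1 F)
    (h : PropertyStar F ∨
      (1 / 2 : ℝ≥0∞) < ⨅ (a : ↥(accPoints K)ᶜ) (ω : ℤˣ), ‖(F (signedIndicator a ω)).1‖ₑ) :
    Isometry F := by
  have : TotallySeparatedSpace K := totallySeparatedSpace_of_t0_of_basis_clopen hzero
  set B : Set C(K, ℝ) := Metric.closedBall 0 1 with hB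
  -- Extend `F` to a self-map of `C(K)`, and choose preimages.
  classical
  let Φ : C(K, ℝ) → C(K, ℝ) := fun f => if hf : f ∈ B then (F ⟨f, hf⟩).1 else f
  have hΦ : ∀ f : UnitBall K, Φ f.1 = (F f).1 := fun f => dif_pos f.2
  have hΦbij : BijOn Φ B B := by
    refine ⟨fun f hf => ?_, fun f hf g hg hfg => ?_, fun g hg => ?_⟩
    · rw [hΦ ⟨f, hf⟩]
      exact (F ⟨f, hf⟩).2
    · rw [hΦ ⟨f, hf⟩, hΦ ⟨g, hg⟩] at hfg
      exact congrArg Subtype.val (hbij.1 (Subtype.ext hfg))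
    · obtain ⟨f, hf⟩ := hbij.2 ⟨g, hg⟩
      exact ⟨f.1, f.2, by rw [hΦ, hf]⟩
  have hΦlip : LipschitzOnWith 1 Φ B := LipschitzOnWith.of_dist_le_mul fun f hf g hg => by
    rw [hΦ ⟨f, hf⟩, hΦ ⟨g, hg⟩]
    exact hF.dist_le_mul ⟨f, hf⟩ ⟨g, hg⟩
  have hinv : ∀ g, ∃ f, g ∈ B → f ∈ B ∧ Φ f = g := fun g => by
    by_cases hg : g ∈ B
    · obtain ⟨f, hf, hfg⟩ := hΦbij.surjOn hg
      exact ⟨f, fun _ => ⟨hf, hfg⟩⟩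
    · exact ⟨0, fun h => absurd h hg⟩
  choose G hGB using hinv
  have hG : ∀ e, IsSign e → IsSign (G e) ∧ Φ (G e) = e := fun e he => by
    obtain ⟨h1, h2⟩ := hGB e he.mem_unitBall
    exact ⟨isSign_of_isSign_apply hΦbij hΦlip h1 (h2.symm ▸ he), h2⟩
  have hGneg : ∀ e, IsSign e → G (-e) = -G e := fun e he =>
    eq_neg_of_apply_eq_neg hΦbij hΦlip (hG e he).1.mem_unitBall (hG _ he.neg).1.mem_unitBall
      ((hG e he).2.symm ▸ he) (by rw [(hG e he).2, (hG _ he.neg).2])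
  have hiso : ∀ {a : K}, a ∈ (accPoints K)ᶜ ↔ IsOpen ({a} : Set K) := fun {a} =>
    ⟨isOpen_singleton_of_notMem_accPoints, fun ha => by
      rw [isOpen_singleton_iff_punctured_nhds] at ha
      simp [accPoints, mem_derivedSet, AccPt, ha]⟩
  have hdense' : Dense {a : K | IsOpen ({a} : Set K)} :=
    hdense.mono fun a ha => hiso.1 ha
  obtain ⟨σ, hσ⟩ := exists_pointMap hΦbij hΦlip hG hGneg hdense'
  have hcont := continuous_pointMap hzero hG hσ
  have hinj : Function.Injective σ := by
    rcases h with h | h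
    · refine injective_pointMap_of_exists_sign hΦbij hΦlip hG hGneg hdense' hσ hcont
        fun u v z huv ω hω => ?_
      obtain ⟨ω', hω'⟩ : ∃ ω' : ℤˣ, ((ω' : ℤ) : ℝ) = ω := by
        rcases hω with rfl | rfl
        · exact ⟨1, by simp⟩
        · exact ⟨-1, by simp⟩
      obtain ⟨f, hf, hz⟩ := h u v z huv ω'
      refine ⟨f.1, f.2, ?_, ?_⟩
      · -- `Real.sign` vanishes only at `0`, so `ω` is the sign of a nonzero product.
        rw [hω'] at hf
        rcases lt_trichotomy (f.1 u * f.1 v) 0 with h0 | h0 | h0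
        · rw [Real.sign_of_neg h0] at hf
          rw [← hf]
          linarith
        · rw [h0, Real.sign_zero] at hf
          rcases hω with h' | h' <;> rw [h'] at hf <;> norm_num at hf
        · rw [Real.sign_of_pos h0] at hf
          rw [← hf]
          linarith
      · rw [hΦ]
        exact hz
    · obtain ⟨c, hc1, hc2⟩ := ENNReal.lt_iff_exists_nnreal_btwn.1 h
      have hc : (1 / 2 : ℝ) < c := by
        have h2 : ((1 / 2 : NNReal) : ℝ≥0∞) < c := by
          simpa using hc1
        have := NNReal.coe_lt_coe.2 (ENNReal.coe_lt_coe.1 h2)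
        simpa using this
      refine injective_pointMap_of_lt_norm hΦbij hΦlip hG hGneg hdense' hσ hcont hc
        fun a ha ω hω => ?_
      obtain ⟨ω', hω'⟩ : ∃ ω' : ℤˣ, ((ω' : ℤ) : ℝ) = ω := by
        rcases hω with rfl | rfl
        · exact ⟨1, by simp⟩
        · exact ⟨-1, by simp⟩
      have h1 := hc2.trans_le ((iInf_le _ ⟨a, hiso.2 ha⟩).trans (iInf_le _ ω'))
      have h2 : spike ha ω = (signedIndicator ⟨a, hiso.2 ha⟩ ω').1 := by
        ext x
        by_cases hx : x = a
        · subst hx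
          simp [spike_self, signedIndicator, hω']
        · simp [spike_of_ne ha ω hx, signedIndicator, hx]
      rw [h2, hΦ]
      rw [enorm_eq_nnnorm, ENNReal.coe_lt_coe] at h1
      exact_mod_cast h1.le
  refine Isometry.of_dist_eq fun f g => ?_
  have := dist_apply_eq_of_injective_pointMap hΦbij hΦlip hG hσ hcont hinj f.2 g.2
  rwa [hΦ, hΦ] at this
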